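/- **Corollary (Ergodic Capacity Lower Bound).** Let $N\ge 1$ be the number of ports, $W>0$ the normalized aperture, $\eta>0$ the mean channel power and $\bar\gamma>0$ the average SNR. Let $\mathbf R\in\mathbb C^{N\times N}$ be the Jakes correlation matrix, $[\mathbf R]_{k,l}=J_0\!\left(\frac{2\pi|k-l|W}{N-1}\right)$, where $J_0(x)=\frac1\pi\int_0^\pi\cos(x\sin\theta)\,d\theta$ is the zeroth-order Bessel function of the first kind (for $N=1$, $\mathbf R=[1]$). Let $\mathbf R=\mathbf U\,\mathrm{diag}(\lambda_1,\dots,\lambda_N)\,\mathbf U^H$ be any eigendecomposition with $\mathbf U=(u_{n,k})$ unitary and $\lambda_1\ge\lambda_2\ge\dots\ge\lambda_N$. Let $\mathbf g=(g_1,\dots,g_N)^T$ be a zero-mean circularly symmetric complex Gaussian vector, $\mathbf g\sim\mathcal{CN}(\mathbf 0,\eta\mathbf R)$, and let $z_1,\dots,z_N$ be i.i.d. $\mathcal{CN}(0,1)$ random variables. For $0\le K\le N$ define the $K$-truncated Karhunen–Loève channel $$\tilde g^{(K)}_n=\sqrt\eta\sum_{k=1}^K\sqrt{\lambda_k}\,u_{n,k}\,z_k,\qquad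 n=1,\dots,N,$$ and the ergodic capacities $$\bar C=\mathbb E\Big[\log_2\Big(1+\bar\gamma\max_{1\le n\le N}\tfrac{|g_n|^2}{\eta}\Big)\Big],\qquad \bar C^{(K)}_{\mathrm{KL}}=\mathbb E\Big[\log_2\Big(1+\bar\gamma\max_{1\le n\le N}\tfrac{|\tilde g^{(K)}_n|^2}{\eta}\Big)\Big].$$ Then both expectations are finite, and for every $0\le K\le N$ $$\bar C^{(K)}_{\mathrm{KL}}\le\bar C,$$ with equality if and only if $K=N$. -/

import Mathlib

open MeasureTheory ProbabilityTheory

noncomputable section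

namespace FAS

/-- The zeroth-order Bessel function of the first kind, through Bessel's integral
`J₀(x) = (1/π) ∫₀^π cos (x sin θ) dθ`. -/
def besselJ0 (x : ℝ) : ℝ :=
  (1 / Real.pi) * ∫ θ in (0 : ℝ)..Real.pi, Real.cos (x * Real.sin θ)

/-- The Jakes correlation matrix of `N` ports on a linear aperture of normalized length `W`, with
entries `J₀(2π |k - l| W / (N - 1))`. For `N = 1` its only entry is `J₀(0) = 1`. -/
def jakesMatrix (N : ℕ) (W : ℝ) : Matrix (Fin N) (Fin N) ℂ :=
  Matrix.of fun k l =>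
    ((besselJ0 (2 * Real.pi * |((k : ℕ) : ℝ) - ((l : ℕ) : ℝ)| * W / ((N : ℝ) - 1)) : ℝ) : ℂ)

/-- The law `CN(0, 1)` of `X + iY` with `X`, `Y` independent real Gaussians `N(0, 1/2)`. -/
def stdComplexGaussian : Measure ℂ :=
  ((gaussianReal 0 (1 / 2)).prod (gaussianReal 0 (1 / 2))).map
    fun p : ℝ × ℝ => (p.1 : ℂ) + Complex.I * (p.2 : ℂ)

/-- `g` is a zero-mean circularly symmetric complex Gaussian vector with covariance matrix
`S = E[g gᴴ]`, i.e. `g ∼ CN(0, S)`: its characteristic function is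
`E[exp (i Re(vᴴ g))] = exp (-(vᴴ S v) / 4)`. -/
structure IsComplexGaussian {Ω : Type*} [MeasurableSpace Ω] {N : ℕ} (P : Measure Ω)
    (S : Matrix (Fin N) (Fin N) ℂ) (g : Ω → Fin N → ℂ) : Prop where
  aemeasurable : AEMeasurable g P
  charFun_eq : ∀ v : Fin N → ℂ,
    ∫ ω, Complex.exp (Complex.I * (((star v ⬝ᵥ g ω).re : ℝ) : ℂ)) ∂P
      = Complex.exp (-(star v ⬝ᵥ S.mulVec v) / 4)

/-- `R = U Λ Uᴴ` with `U` unitary, `Λ = diag lam` and `lam 0 ≥ lam 1 ≥ …`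
(the `k`-th column of `U` is the `k`-th eigenvector). -/
structure IsOrderedEigendecomposition {N : ℕ} (R U : Matrix (Fin N) (Fin N) ℂ)
    (lam : Fin N → ℝ) : Prop where
  unitary : U ∈ Matrix.unitaryGroup (Fin N) ℂ
  antitone : Antitone lam
  eq : R = U * Matrix.diagonal (fun k => (lam k : ℂ)) * U.conjTranspose

/-- The `K`-truncated Karhunen–Loève channel
`g̃ₙ = √η ∑_{k ≤ K} √λₖ uₙₖ zₖ` (the first `K` modes are those with 0-based index `< K`). -/
def klChannel {Ω : Type*} {N : ℕ} (η : ℝ) (U : Matrix (Fin N) (Fin N) ℂ) (lam : Fin N → ℝ)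
    (z : Fin N → Ω → ℂ) (K : ℕ) (ω : Ω) (n : Fin N) : ℂ :=
  ((√η : ℝ) : ℂ) *
    ∑ k ∈ Finset.univ.filter (fun k : Fin N => (k : ℕ) < K), ((√(lam k) : ℝ) : ℂ) * U n k * z k ω

/-- The instantaneous rate `log₂ (1 + γ̄ maxₙ |gₙ|² / η)` under selection of the best port. -/
def rate {N : ℕ} (γ η : ℝ) (g : Fin N → ℂ) : ℝ :=
  Real.logb 2 (1 + γ * ⨆ n : Fin N, ‖g n‖ ^ 2 / η)

/-- The ergodic capacity `E[log₂ (1 + γ̄ maxₙ |gₙ|² / η)]` of the random channel `g`. -/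
def ergodicCapacity {Ω : Type*} [MeasurableSpace Ω] {N : ℕ} (P : Measure Ω) (γ η : ℝ)
    (g : Ω → Fin N → ℂ) : ℝ :=
  ∫ ω, rate γ η (g ω) ∂P

end FAS

end

/-!
The capacity gap is a strict submean inequality. For `a, b : ℂ` with `b ≠ 0`, the average of
`log (1 + |a + w b|²)` over the unit circle exceeds `log (1 + |a|²)`: on the circle
`1 + |a + w b|² = |α + β w|²` with `α² > 1 + |a|²`, so that Jensen's formula evaluates the average
as `2 log (max |α| |β|)` (`log_one_add_sq_lt_circleAverage`). Hence the rate of the channel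
`a + w b`, averaged over the phase `w`, is at least the rate of `a`: it suffices to look at the best
port of `a` (`rate_le_circleAverage`). The inequality is strict when some entry of `b` dominates
`a` (`rate_lt_circleAverage`).

Write `z` for a vector of `N` independent `CN(0, 1)` variables. By uniqueness of characteristic
functions `g` has the law of the full expansion `(A + B) z`, where `A z` collects the first `K`
modes and `B z` the others (`IsComplexGaussian.map_eq`, `klMatrix_mul_conjTranspose`). Rotating the
last coordinates of `z` by a common phase `w` preserves the law of `z`, so `(A + w B) z` has the law
of `(A + B) z` (`klMatrix_phase_invariant`). Averaging over `w` by Fubini gives the capacity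
inequality, and it is strict because `B z` dominates `A z` on a nonempty open set, which has
positive measure (`integral_rate_lt_of_phase_invariant`).

That `B ≠ 0` for `K < N` rests on the positivity of all eigenvalues of the Jakes matrix
(`IsOrderedEigendecomposition.lam_pos`): its quadratic form is an integral of squared moduli of
trigonometric polynomials, which cannot vanish throughout an interval.
-/

open MeasureTheory ProbabilityTheory

namespace FAS

/-! ### Circle averages of logarithms -/

open Real in
/-- Strict submean property of `log (1 + |·|²)` on circles, from the factorization
`1 + |a + w b|² = |α + β w|²` for `|w| = 1`. -/
theorem log_one_add_sq_lt_circleAverage (a : ℂ) {b : ℂ} (hb : b ≠ 0) :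
    Real.log (1 + ‖a‖ ^ 2) < circleAverage (fun w => Real.log (1 + ‖a + w * b‖ ^ 2)) 0 1 := by
  set A := ‖a‖ ^ 2 with hA
  set B := ‖b‖ ^ 2 with hB
  have hA0 : 0 ≤ A := by positivity
  have hB0 : 0 < B := by positivity
  set D := (1 + A - B) ^ 2 + 4 * B with hD
  have hD0 : 0 ≤ D := by positivity
  set s := (1 + A + B + √D) / 2 with hs
  have hsD : √D ^ 2 = D := Real.sq_sqrt hD0
  have hlt : 1 + A - B < √D := Real.lt_sqrt_of_sq_lt (by rw [hD]; linarith)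
  have hAs : 1 + A < s := by rw [hs]; linarith
  have hs0 : 0 < s := by linarith
  -- `s` is the larger root of `s² - (1 + A + B) s + A B`.
  have hroot : s * s + A * B = (1 + A + B) * s := by
    rw [hs]; nlinarith
  have hα0 : 0 < √s := Real.sqrt_pos.2 hs0
  set β : ℂ := (starRingEnd ℂ a) * b / (√s : ℝ) with hβ
  have hαC : ((√s : ℝ) : ℂ) ≠ 0 := by exact_mod_cast hα0.ne'
  have hβα : β * (√s : ℝ) = (starRingEnd ℂ a) * b := by rw [hβ]; field_simp
  have hβn : ‖β‖ ^ 2 * s = A * B := by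
    have h := congrArg (fun x : ℂ => ‖x‖ ^ 2) hβα
    simp only [norm_mul, RCLike.norm_conj, mul_pow, Complex.norm_real, Real.norm_eq_abs,
      sq_abs] at h
    rw [Real.sq_sqrt hs0.le] at h
    exact h
  have key : ∀ w : ℂ, ‖w‖ = 1 → 1 + ‖a + w * b‖ ^ 2 = ‖((√s : ℝ) : ℂ) + w * β‖ ^ 2 := by
    intro w hw
    have e1 : ‖a + w * b‖ ^ 2 = A + B + 2 * ((starRingEnd ℂ a) * b * w).re := by
      rw [← Complex.normSq_eq_norm_sq, Complex.normSq_add, Complex.normSq_eq_norm_sq,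
        Complex.normSq_eq_norm_sq, norm_mul, hw, one_mul, ← Complex.conj_re]
      congr 3
      simp; ring
    have e2 : ‖((√s : ℝ) : ℂ) + w * β‖ ^ 2 =
        s + ‖β‖ ^ 2 + 2 * ((starRingEnd ℂ a) * b * w).re := by
      rw [← Complex.normSq_eq_norm_sq, Complex.normSq_add, Complex.normSq_eq_norm_sq,
        Complex.normSq_eq_norm_sq, norm_mul, hw, one_mul, ← Complex.conj_re, ← hβα,
        Complex.norm_real, Real.norm_eq_abs, sq_abs, Real.sq_sqrt hs0.le]
      congr 3
      simp; ring
    have e3 : s + ‖β‖ ^ 2 = 1 + A + B := by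
      apply mul_right_cancel₀ hs0.ne'
      rw [add_mul, hβn, hroot]
    rw [e1, e2, e3]; ring
  have hlogs : Real.log (1 + A) < Real.log s := Real.log_lt_log (by linarith) hAs
  refine hlogs.trans_le ?_
  rcases eq_or_ne β 0 with h0 | h0
  · have : circleAverage (fun w => Real.log (1 + ‖a + w * b‖ ^ 2)) 0 1
        = circleAverage (fun _ => Real.log s) 0 1 := by
      apply circleAverage_congr_sphere
      intro w hw
      have hw : ‖w‖ = 1 := by simpa using hw
      simp only [key w hw, h0, mul_zero, add_zero, Complex.norm_real, Real.norm_eq_abs, sq_abs,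
        Real.sq_sqrt hs0.le]
    rw [this, circleAverage_const]
  · have hint : CircleIntegrable (fun w : ℂ => Real.log ‖w + (√s : ℝ) / β‖) 0 1 := by
      simpa using circleIntegrable_log_norm_sub_const (a := -((√s : ℝ) / β)) (c := 0) 1
    have : circleAverage (fun w => Real.log (1 + ‖a + w * b‖ ^ 2)) 0 1
        = circleAverage (fun w => 2 * Real.log ‖β‖ + (2 : ℝ) • Real.log ‖w + (√s : ℝ) / β‖) 0 1 := by
      apply circleAverage_congr_sphere
      intro w hw
      have hw : ‖w‖ = 1 := by simpa using hw
      have hf : ((√s : ℝ) : ℂ) + w * β = β * (w + (√s : ℝ) / β) := by field_simp; ring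
      have hpos : 0 < ‖((√s : ℝ) : ℂ) + w * β‖ ^ 2 := by rw [← key w hw]; positivity
      rw [hf, norm_mul] at hpos
      have h1 : ‖w + (√s : ℝ) / β‖ ≠ 0 := by
        intro h; rw [h] at hpos; simp at hpos
      simp only [key w hw, hf, norm_mul, smul_eq_mul]
      rw [Real.log_pow, Real.log_mul (norm_ne_zero_iff.2 h0) h1]
      push_cast; ring
    rw [this, circleAverage_fun_add (circleIntegrable_const _ _ _)
      (f₂ := fun w : ℂ => (2 : ℝ) • Real.log ‖w + (√s : ℝ) / β‖) (hint.const_mul 2), circleAverage_const,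
      circleAverage_fun_smul]
    have h2 := circleAverage_log_norm_add_const_eq_posLog (a := ((√s : ℝ) : ℂ) / β)
    rw [h2]
    have h3 : Real.log ‖((√s : ℝ) : ℂ) / β‖ ≤ log⁺ ‖((√s : ℝ) : ℂ) / β‖ := le_max_right _ _
    rw [norm_div, Real.log_div (norm_ne_zero_iff.2 hαC) (norm_ne_zero_iff.2 h0), Complex.norm_real,
      Real.norm_eq_abs, abs_of_pos hα0, Real.log_sqrt hs0.le] at h3
    rw [norm_div _ β, Complex.norm_real, Real.norm_eq_abs, abs_of_pos hα0, smul_eq_mul]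
    linarith

open Real in
theorem log_one_add_mul_sq_lt_circleAverage {c : ℝ} (hc : 0 < c) (a : ℂ) {b : ℂ} (hb : b ≠ 0) :
    Real.log (1 + c * ‖a‖ ^ 2)
      < circleAverage (fun w => Real.log (1 + c * ‖a + w * b‖ ^ 2)) 0 1 := by
  have hc' : ((√c : ℝ) : ℂ) ≠ 0 := by exact_mod_cast (Real.sqrt_pos.2 hc).ne'
  have h := log_one_add_sq_lt_circleAverage ((√c : ℝ) * a) (mul_ne_zero hc' hb)
  have e : ∀ x : ℂ, ‖((√c : ℝ) : ℂ) * x‖ ^ 2 = c * ‖x‖ ^ 2 := by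
    intro x
    rw [norm_mul, mul_pow, Complex.norm_real, Real.norm_eq_abs, sq_abs, Real.sq_sqrt hc.le]
  simpa only [mul_left_comm _ ((√c : ℝ) : ℂ), ← mul_add, e] using h

/-! ### Positive definiteness of the Jakes matrix -/

/-- A trigonometric polynomial that vanishes at `s = a sin θ` for all `θ ∈ [0, π]` is zero. -/
theorem eq_zero_of_sum_exp_eq_zero {N : ℕ} {a : ℝ} (ha : 0 < a) (c : Fin N → ℂ)
    (h : ∀ θ ∈ Set.Icc 0 Real.pi,
      ∑ k, c k * Complex.exp ((a * Real.sin θ : ℝ) * Complex.I) ^ (k : ℕ) = 0) : c = 0 := by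
  set p : Polynomial ℂ := ∑ k : Fin N, Polynomial.C (c k) * Polynomial.X ^ (k : ℕ) with hp
  have hroot : ∀ s ∈ Set.Ioo 0 (min a Real.pi), p.IsRoot (Complex.exp ((s : ℝ) * Complex.I)) := by
    rintro s ⟨h0, h1⟩
    have hsa : s < a := h1.trans_le (min_le_left _ _)
    have h2 : s / a ≤ 1 := (div_le_one ha).2 hsa.le
    have h3 : 0 ≤ s / a := by positivity
    have := h (Real.arcsin (s / a)) ⟨Real.arcsin_nonneg.2 h3,
      (Real.arcsin_le_pi_div_two _).trans (by linarith [Real.pi_pos])⟩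
    rw [Real.sin_arcsin (by linarith) h2, mul_div_cancel₀ _ ha.ne'] at this
    simpa [hp, Polynomial.IsRoot, Polynomial.eval_finsetSum] using this
  have hinj : Set.InjOn (fun s : ℝ => Complex.exp ((s : ℝ) * Complex.I))
      (Set.Ioo 0 (min a Real.pi)) := by
    rintro s ⟨h0, h1⟩ t ⟨h0', h1'⟩ hst
    have h1 := h1.trans_le (min_le_right _ _)
    have h1' := h1'.trans_le (min_le_right _ _)
    have := Complex.exp_inj_of_neg_pi_lt_of_le_pi (x := s * Complex.I) (y := t * Complex.I)
      (by simp; linarith) (by simp; linarith) (by simp; linarith) (by simp; linarith) hst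
    simpa using congrArg Complex.im this
  have hp0 : p = 0 := by
    apply Polynomial.eq_zero_of_infinite_isRoot
    refine Set.Infinite.mono ?_
      ((Set.infinite_image_iff hinj).2 (Set.Ioo_infinite (lt_min ha Real.pi_pos)))
    rintro _ ⟨s, hs, rfl⟩
    exact hroot s hs
  funext k
  have := congrArg (fun q => Polynomial.coeff q (k : ℕ)) hp0
  simpa [hp, Polynomial.finsetSum_coeff, Polynomial.coeff_X_pow, Fin.val_inj] using this

/-- By the addition formula for the cosine, the quadratic form of the Jakes matrix is an average over
`θ` of `|∑ cₖ cos (k a sin θ)|² + |∑ cₖ sin (k a sin θ)|²`. -/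
theorem jakes_quadraticForm_pos {N : ℕ} {W : ℝ} (hW : 0 < W) {c : Fin N → ℂ} (hc : c ≠ 0) :
    0 < (star c ⬝ᵥ (jakesMatrix N W).mulVec c).re := by
  -- The step `a` is `2πW / (N - 1)`; for `N = 1` the only entry does not depend on it.
  obtain ⟨a, ha, hent⟩ : ∃ a : ℝ, 0 < a ∧ ∀ k l : Fin N,
      2 * Real.pi * |((k : ℕ) : ℝ) - ((l : ℕ) : ℝ)| * W / ((N : ℝ) - 1)
        = a * |((k : ℕ) : ℝ) - ((l : ℕ) : ℝ)| := by
    rcases Nat.lt_or_ge 1 N with h | h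
    · have : (1 : ℝ) < N := by exact_mod_cast h
      have : 0 < (N : ℝ) - 1 := by linarith
      exact ⟨2 * Real.pi * W / ((N : ℝ) - 1), by positivity, fun k l => by ring⟩
    · refine ⟨1, one_pos, fun k l => ?_⟩
      have : k = l := by ext; omega
      simp [this]
  have hJ : ∀ k l : Fin N, jakesMatrix N W k l =
      (((1 / Real.pi) * ∫ θ in (0 : ℝ)..Real.pi,
        (Real.cos (k * (a * Real.sin θ)) * Real.cos (l * (a * Real.sin θ)) +
          Real.sin (k * (a * Real.sin θ)) * Real.sin (l * (a * Real.sin θ))) : ℝ) : ℂ) := by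
    intro k l
    simp only [jakesMatrix, Matrix.of_apply, besselJ0, hent]
    congr 2
    refine intervalIntegral.integral_congr fun θ _ => ?_
    rw [← Real.cos_sub, ← Real.cos_abs, ← Real.cos_abs ((k : ℕ) * (a * Real.sin θ) - _), ← sub_mul,
      abs_mul, abs_mul, abs_mul _ (a * _), abs_mul, abs_abs]
    congr 1; ring
  have hF : (star c ⬝ᵥ (jakesMatrix N W).mulVec c).re = (1 / Real.pi) *
      ∫ θ in (0 : ℝ)..Real.pi, (‖∑ k, c k * (Real.cos (k * (a * Real.sin θ)) : ℝ)‖ ^ 2 +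
        ‖∑ k, c k * (Real.sin (k * (a * Real.sin θ)) : ℝ)‖ ^ 2) := by
    have hsq : ∀ x : Fin N → ℝ, ‖∑ k, c k * (x k : ℂ)‖ ^ 2
        = ∑ k, ∑ l, (starRingEnd ℂ (c k) * c l).re * (x k * x l) := by
      intro x
      have : ((‖∑ k, c k * (x k : ℂ)‖ ^ 2 : ℝ) : ℂ) =
          starRingEnd ℂ (∑ k, c k * (x k : ℂ)) * ∑ k, c k * (x k : ℂ) := by
        rw [Complex.conj_mul']; norm_cast
      have h2 := congrArg Complex.re this
      rw [Complex.ofReal_re, map_sum, Finset.sum_mul_sum, Complex.re_sum] at h2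
      rw [h2]
      refine Finset.sum_congr rfl fun k _ => ?_
      rw [Complex.re_sum]
      refine Finset.sum_congr rfl fun l _ => ?_
      simp; ring
    simp only [hsq, ← Finset.sum_add_distrib, ← mul_add]
    rw [intervalIntegral.integral_finsetSum
      (fun k _ => Continuous.intervalIntegrable (by fun_prop) _ _), Finset.mul_sum]
    simp only [dotProduct, Matrix.mulVec, Complex.re_sum, Finset.mul_sum]
    refine Finset.sum_congr rfl fun k _ => ?_
    rw [intervalIntegral.integral_finsetSum
      (fun k _ => Continuous.intervalIntegrable (by fun_prop) _ _), Finset.mul_sum]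
    refine Finset.sum_congr rfl fun l _ => ?_
    rw [intervalIntegral.integral_const_mul, hJ, mul_left_comm, Complex.re_ofReal_mul]
    simp only [Pi.star_apply, RCLike.star_def]
    ring
  rw [hF]
  refine mul_pos (by positivity) ?_
  refine intervalIntegral.integral_pos Real.pi_pos (Continuous.continuousOn (by fun_prop))
    (fun θ _ => by positivity) ?_
  by_contra! hcon
  refine hc (eq_zero_of_sum_exp_eq_zero ha c fun θ hθ => ?_)
  have h0 := hcon θ hθ
  have h1 : ∑ k, c k * (Real.cos (k * (a * Real.sin θ)) : ℝ) = 0 := by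
    have : ‖∑ k, c k * (Real.cos (k * (a * Real.sin θ)) : ℝ)‖ ^ 2 ≤ 0 := by
      nlinarith [sq_nonneg ‖∑ k, c k * (Real.sin (k * (a * Real.sin θ)) : ℝ)‖]
    simpa using le_antisymm this (by positivity)
  have h2 : ∑ k, c k * (Real.sin (k * (a * Real.sin θ)) : ℝ) = 0 := by
    have : ‖∑ k, c k * (Real.sin (k * (a * Real.sin θ)) : ℝ)‖ ^ 2 ≤ 0 := by
      nlinarith [sq_nonneg ‖∑ k, c k * (Real.cos (k * (a * Real.sin θ)) : ℝ)‖]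
    simpa using le_antisymm this (by positivity)
  calc ∑ k, c k * Complex.exp ((a * Real.sin θ : ℝ) * Complex.I) ^ (k : ℕ)
      = ∑ k, c k * (Real.cos (k * (a * Real.sin θ)) : ℝ) +
        (∑ k, c k * (Real.sin (k * (a * Real.sin θ)) : ℝ)) * Complex.I := by
        rw [Finset.sum_mul, ← Finset.sum_add_distrib]
        refine Finset.sum_congr rfl fun k _ => ?_
        rw [← Complex.exp_nat_mul, ← mul_assoc, Complex.exp_mul_I]
        push_cast; ring
    _ = 0 := by rw [h1, h2]; simp

theorem IsOrderedEigendecomposition.lam_pos {N : ℕ} {W : ℝ} (hW : 0 < W)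
    {U : Matrix (Fin N) (Fin N) ℂ} {lam : Fin N → ℝ}
    (hU : IsOrderedEigendecomposition (jakesMatrix N W) U lam) (k : Fin N) : 0 < lam k := by
  have hUU : U.conjTranspose * U = 1 := Matrix.mem_unitaryGroup_iff'.1 hU.unitary
  set e : Fin N → ℂ := Pi.single k 1 with he
  have hu : U.conjTranspose.mulVec (U.mulVec e) = e := by
    rw [Matrix.mulVec_mulVec, hUU, Matrix.one_mulVec]
  have hne : U.mulVec e ≠ 0 := by
    intro h
    rw [h, Matrix.mulVec_zero] at hu
    simpa [he] using congrFun hu.symm k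
  have h := jakes_quadraticForm_pos hW hne
  have hs := Matrix.star_mulVec U.conjTranspose (U.mulVec e)
  rw [hu, Matrix.conjTranspose_conjTranspose] at hs
  rw [hU.eq, ← Matrix.mulVec_mulVec, hu, ← Matrix.mulVec_mulVec, Matrix.dotProduct_mulVec,
    ← hs] at h
  simpa [he, Matrix.mulVec_single, dotProduct, Matrix.diagonal_apply, Pi.single_apply] using h

/-! ### Complex Gaussian vectors -/

instance : IsProbabilityMeasure stdComplexGaussian :=
  Measure.isProbabilityMeasure_map (by fun_prop)

instance : stdComplexGaussian.IsOpenPosMeasure := by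
  have : (gaussianReal 0 (1 / 2)).IsOpenPosMeasure :=
    (gaussianReal_absolutelyContinuous' 0 (by norm_num)).isOpenPosMeasure
  refine Continuous.isOpenPosMeasure_map (by fun_prop) fun z => ⟨(z.re, z.im), ?_⟩
  apply Complex.ext <;> simp

theorem memLp_id_stdComplexGaussian : MemLp id 2 stdComplexGaussian := by
  rw [stdComplexGaussian, memLp_map_measure_iff (by fun_prop) (by fun_prop)]
  have h := memLp_id_gaussianReal' (μ := 0) (v := 1 / 2) 2 (by simp)
  have h1 := (h.comp_fst (gaussianReal 0 (1 / 2))).ofReal (K := ℂ)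
  have h2 := (h.comp_snd (gaussianReal 0 (1 / 2))).ofReal (K := ℂ)
  exact h1.add (h2.const_mul Complex.I)

theorem integral_exp_stdComplexGaussian (t : ℂ) :
    ∫ x, Complex.exp (Complex.I * (((star t * x).re : ℝ) : ℂ)) ∂stdComplexGaussian
      = Complex.exp (-((‖t‖ ^ 2 : ℝ) : ℂ) / 4) := by
  have h1 (s : ℝ) : ∫ x, Complex.exp (s * x * Complex.I) ∂(gaussianReal 0 (1 / 2))
      = Complex.exp (-(s : ℂ) ^ 2 / 4) := by
    rw [← charFun_apply_real, charFun_gaussianReal]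
    congr 1
    push_cast; ring
  rw [stdComplexGaussian, integral_map (by fun_prop) (by fun_prop)]
  calc _ = ∫ p : ℝ × ℝ, Complex.exp (t.re * p.1 * Complex.I) * Complex.exp (t.im * p.2 * Complex.I)
        ∂((gaussianReal 0 (1 / 2)).prod (gaussianReal 0 (1 / 2))) := by
        refine integral_congr_ae (Filter.Eventually.of_forall fun p => ?_)
        simp only
        rw [← Complex.exp_add]
        congr 1
        simp; ring
    _ = _ := by
        rw [integral_prod_mul (fun x : ℝ => Complex.exp (t.re * x * Complex.I))
          (fun x : ℝ => Complex.exp (t.im * x * Complex.I)), h1, h1, ← Complex.exp_add]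
        congr 1
        rw [← Complex.normSq_eq_norm_sq, Complex.normSq_apply]
        push_cast; ring

/-- The law of `N` independent `CN(0, 1)` variables. -/
noncomputable abbrev whiteNoise (N : ℕ) : Measure (Fin N → ℂ) :=
  Measure.pi fun _ => stdComplexGaussian

theorem integral_exp_whiteNoise {N : ℕ} (v : Fin N → ℂ) :
    ∫ z, Complex.exp (Complex.I * (((star v ⬝ᵥ z).re : ℝ) : ℂ)) ∂(whiteNoise N)
      = Complex.exp (-(star v ⬝ᵥ v) / 4) := by
  have h : ∀ z : Fin N → ℂ, Complex.exp (Complex.I * (((star v ⬝ᵥ z).re : ℝ) : ℂ))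
      = ∏ k, Complex.exp (Complex.I * (((star (v k) * z k).re : ℝ) : ℂ)) := by
    intro z
    rw [← Complex.exp_sum, dotProduct, Complex.re_sum, Complex.ofReal_sum, Finset.mul_sum]
    rfl
  simp only [h]
  rw [integral_fintype_prod_eq_prod
    (fun k (x : ℂ) => Complex.exp (Complex.I * (((star (v k) * x).re : ℝ) : ℂ)))]
  simp only [integral_exp_stdComplexGaussian]
  rw [← Complex.exp_sum, dotProduct, ← Finset.sum_div, Finset.sum_neg_distrib]
  congr 4
  funext k
  rw [Pi.star_apply, RCLike.star_def, Complex.conj_mul']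
  push_cast; rfl

/-- A finite measure on `ℂᴺ` is determined by its characteristic function `v ↦ E[exp (i Re (vᴴ x))]`,
the normalization used in `IsComplexGaussian`. -/
theorem measure_ext_of_integral_exp {N : ℕ} {μ ν : Measure (Fin N → ℂ)} [IsFiniteMeasure μ]
    [IsFiniteMeasure ν] (h : ∀ v : Fin N → ℂ,
      ∫ x, Complex.exp (Complex.I * (((star v ⬝ᵥ x).re : ℝ) : ℂ)) ∂μ
        = ∫ x, Complex.exp (Complex.I * (((star v ⬝ᵥ x).re : ℝ) : ℂ)) ∂ν) : μ = ν := by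
  refine Measure.ext_of_charFunDual ?_
  ext L
  -- Every real linear functional on `ℂᴺ` is `Re (vᴴ ·)`.
  obtain ⟨v, hv⟩ : ∃ v : Fin N → ℂ, ∀ x, L x = (star v ⬝ᵥ x).re := by
    refine ⟨fun k => ((L (Pi.single k 1) : ℝ) : ℂ) +
      ((L (Pi.single k Complex.I) : ℝ) : ℂ) * Complex.I, fun x => ?_⟩
    have hx : x = ∑ k, ((x k).re • (Pi.single k 1 : Fin N → ℂ) +
        (x k).im • (Pi.single k Complex.I : Fin N → ℂ)) := by
      funext j
      have h1 : ∀ k, ((x k).re • (Pi.single k 1 : Fin N → ℂ) +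
          (x k).im • (Pi.single k Complex.I : Fin N → ℂ)) j = if j = k then x j else 0 := by
        intro k
        rcases eq_or_ne j k with rfl | hjk
        · simp [Complex.re_add_im]
        · simp [hjk]
      rw [Finset.sum_apply]
      simp only [h1, Finset.sum_ite_eq, Finset.mem_univ, if_true]
    conv_lhs => rw [hx]
    rw [map_sum, dotProduct, Complex.re_sum]
    refine Finset.sum_congr rfl fun k _ => ?_
    simp; ring
  rw [charFunDual_apply, charFunDual_apply]
  simp only [hv, mul_comm _ Complex.I]
  exact h v

theorem isComplexGaussian_mulVec_whiteNoise {N : ℕ} (M : Matrix (Fin N) (Fin N) ℂ) :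
    IsComplexGaussian (whiteNoise N) (M * M.conjTranspose) M.mulVec where
  aemeasurable := by fun_prop
  charFun_eq v := by
    have h : ∀ z, star v ⬝ᵥ M.mulVec z = star (M.conjTranspose.mulVec v) ⬝ᵥ z := by
      intro z
      rw [Matrix.star_mulVec, Matrix.conjTranspose_conjTranspose, Matrix.dotProduct_mulVec]
    simp only [h]
    rw [integral_exp_whiteNoise, ← h, Matrix.mulVec_mulVec]

theorem IsComplexGaussian.map_eq {Ω Ω' : Type*} [MeasurableSpace Ω] [MeasurableSpace Ω'] {N : ℕ}
    {P : Measure Ω} {P' : Measure Ω'} [IsFiniteMeasure P] [IsFiniteMeasure P']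
    {S : Matrix (Fin N) (Fin N) ℂ} {g : Ω → Fin N → ℂ} {g' : Ω' → Fin N → ℂ}
    (hg : IsComplexGaussian P S g) (hg' : IsComplexGaussian P' S g') : P.map g = P'.map g' := by
  refine measure_ext_of_integral_exp fun v => ?_
  rw [integral_map hg.aemeasurable (by fun_prop), integral_map hg'.aemeasurable (by fun_prop),
    hg.charFun_eq, hg'.charFun_eq]

theorem whiteNoise_map_unitary {N : ℕ} {V : Matrix (Fin N) (Fin N) ℂ}
    (hV : V * V.conjTranspose = 1) : (whiteNoise N).map V.mulVec = whiteNoise N := by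
  have h1 := isComplexGaussian_mulVec_whiteNoise (1 : Matrix (Fin N) (Fin N) ℂ)
  rw [Matrix.conjTranspose_one, mul_one, ← hV] at h1
  rw [(isComplexGaussian_mulVec_whiteNoise V).map_eq h1]
  convert Measure.map_id using 2
  funext z
  simp [hV]

theorem integrable_norm_sq_mulVec {N : ℕ} (M : Matrix (Fin N) (Fin N) ℂ) (n : Fin N) :
    Integrable (fun z => ‖M.mulVec z n‖ ^ 2) (whiteNoise N) := by
  have h : MemLp (fun z : Fin N → ℂ => M.mulVec z n) 2 (whiteNoise N) := by
    simp only [Matrix.mulVec, dotProduct]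
    refine memLp_finsetSum _ fun k _ => MemLp.const_mul ?_ _
    exact memLp_id_stdComplexGaussian.comp_measurePreserving
      (measurePreserving_eval (fun _ => stdComplexGaussian) k)
  exact h.integrable_norm_pow (by norm_num)

/-! ### The rate of a randomly rotated channel -/

/-- The best port `n` determines the rate. -/
theorem exists_rate_eq {N : ℕ} [NeZero N] {η : ℝ} (γ : ℝ) (hη : 0 < η) (x : Fin N → ℂ) :
    ∃ n, rate γ η x = Real.log (1 + γ / η * ‖x n‖ ^ 2) / Real.log 2 ∧ ∀ m, ‖x m‖ ≤ ‖x n‖ := by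
  obtain ⟨n, hn⟩ := Finite.exists_max fun n => ‖x n‖
  refine ⟨n, ?_, hn⟩
  have : ⨆ m, ‖x m‖ ^ 2 / η = ‖x n‖ ^ 2 / η := by
    apply le_antisymm
    · exact ciSup_le fun m => by have := hn m; gcongr
    · exact le_ciSup (f := fun m => ‖x m‖ ^ 2 / η) (Set.finite_range _).bddAbove n
  rw [rate, this, Real.logb]
  congr 2; ring

section rate

variable {N : ℕ} [NeZero N] {γ η : ℝ} (hγ : 0 < γ) (hη : 0 < η)
include hγ hη

theorem le_rate (x : Fin N → ℂ) (m : Fin N) :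
    Real.log (1 + γ / η * ‖x m‖ ^ 2) / Real.log 2 ≤ rate γ η x := by
  obtain ⟨n, hn, hmax⟩ := exists_rate_eq γ hη x
  rw [hn]
  have := hmax m
  have := Real.log_pos one_lt_two
  gcongr

theorem rate_nonneg (x : Fin N → ℂ) : 0 ≤ rate γ η x := by
  refine le_trans (div_nonneg (Real.log_nonneg ?_) (Real.log_nonneg one_le_two))
    (le_rate hγ hη x 0)
  have : 0 ≤ γ / η * ‖x 0‖ ^ 2 := by positivity
  linarith

theorem rate_le_sum (x : Fin N → ℂ) :
    rate γ η x ≤ γ / η / Real.log 2 * ∑ n, ‖x n‖ ^ 2 := by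
  obtain ⟨n, hn, -⟩ := exists_rate_eq γ hη x
  have h2 := Real.log_pos one_lt_two
  have h0 : 0 ≤ γ / η * ‖x n‖ ^ 2 := by positivity
  have h1 := Real.log_le_sub_one_of_pos (x := 1 + γ / η * ‖x n‖ ^ 2) (by linarith)
  have h3 : ‖x n‖ ^ 2 ≤ ∑ n, ‖x n‖ ^ 2 :=
    Finset.single_le_sum (f := fun n => ‖x n‖ ^ 2) (fun _ _ => by positivity) (Finset.mem_univ n)
  rw [hn, div_mul_eq_mul_div (γ / η)]
  refine div_le_div_of_nonneg_right ?_ h2.le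
  calc _ ≤ γ / η * ‖x n‖ ^ 2 := by linarith
    _ ≤ _ := by gcongr

theorem continuous_rate : Continuous (rate γ η : (Fin N → ℂ) → ℝ) := by
  have h : (rate γ η : (Fin N → ℂ) → ℝ) = fun x =>
      Real.log (1 + γ * Finset.univ.sup' Finset.univ_nonempty fun n => ‖x n‖ ^ 2 / η) /
        Real.log 2 := by
    funext x
    rw [rate, Finset.sup'_univ_eq_ciSup, Real.logb]
  rw [h]
  refine (Continuous.log ?_ fun x => ?_).div_const _
  · refine continuous_const.add (continuous_const.mul ?_)
    exact Continuous.finset_sup'_apply _ fun n _ => by fun_prop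
  · have : 0 ≤ Finset.univ.sup' Finset.univ_nonempty fun n => ‖x n‖ ^ 2 / η :=
      Finset.le_sup'_of_le _ (Finset.mem_univ 0) (by positivity)
    positivity

theorem circleIntegrable_rate (a b : Fin N → ℂ) :
    CircleIntegrable (fun w => rate γ η (a + w • b)) 0 1 := by
  have := continuous_rate (N := N) hγ hη
  exact ContinuousOn.circleIntegrable' (Continuous.continuousOn (by fun_prop))

/-- Submean property, in strict form at a port `n` that sees the perturbation. -/
theorem log_lt_circleAverage_rate (a b : Fin N → ℂ) {n : Fin N} (hb : b n ≠ 0) :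
    Real.log (1 + γ / η * ‖a n‖ ^ 2) / Real.log 2
      < Real.circleAverage (fun w => rate γ η (a + w • b)) 0 1 := by
  have h2 := Real.log_pos one_lt_two
  have hpos : ∀ w : ℂ, 1 + γ / η * ‖a n + w * b n‖ ^ 2 ≠ 0 := fun w => by positivity
  have hci : CircleIntegrable (fun w => Real.log (1 + γ / η * ‖a n + w * b n‖ ^ 2)) 0 1 := by
    refine ContinuousOn.circleIntegrable' (Continuous.continuousOn ?_)
    exact Continuous.log (by fun_prop) hpos
  calc _ < (Real.log 2)⁻¹ • Real.circleAverage
        (fun w => Real.log (1 + γ / η * ‖a n + w * b n‖ ^ 2)) 0 1 := by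
        rw [div_eq_inv_mul, smul_eq_mul]
        gcongr
        exact log_one_add_mul_sq_lt_circleAverage (by positivity) (a n) hb
    _ = Real.circleAverage
        (fun w => (Real.log 2)⁻¹ • Real.log (1 + γ / η * ‖a n + w * b n‖ ^ 2)) 0 1 :=
        Real.circleAverage_fun_smul.symm
    _ ≤ _ := by
        refine Real.circleAverage_mono (hci.const_mul _) (circleIntegrable_rate hγ hη a b) ?_
        intro w _
        have := le_rate hγ hη (a + w • b) n
        rwa [div_eq_inv_mul] at this

theorem const_le_circleAverage_rate (a b : Fin N → ℂ) {r : ℝ}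
    (h : ∀ w : ℂ, ‖w‖ = 1 → r ≤ rate γ η (a + w • b)) :
    r ≤ Real.circleAverage (fun w => rate γ η (a + w • b)) 0 1 := by
  rw [← Real.circleAverage_const r 0 1]
  exact Real.circleAverage_mono (circleIntegrable_const _ _ _) (circleIntegrable_rate hγ hη a b)
    fun w hw => h w (by simpa using hw)

theorem rate_le_circleAverage (a b : Fin N → ℂ) :
    rate γ η a ≤ Real.circleAverage (fun w => rate γ η (a + w • b)) 0 1 := by
  obtain ⟨n, hn, -⟩ := exists_rate_eq γ hη a
  rcases eq_or_ne (b n) 0 with hb | hb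
  · refine const_le_circleAverage_rate hγ hη a b fun w _ => ?_
    have := le_rate hγ hη (a + w • b) n
    rw [hn]
    simpa [hb] using this
  · rw [hn]
    exact (log_lt_circleAverage_rate hγ hη a b hb).le

/-- If the best port `n` of `a` has `b n ≠ 0`, the strict submean property at `n` applies. If
`b n = 0`, the port `m` overtakes `n` for every phase `w`, by the hypothesis `hm`. -/
theorem rate_lt_circleAverage (a b : Fin N → ℂ) {m : Fin N} (hm : ∀ n, 2 * ‖a n‖ < ‖b m‖) :
    rate γ η a < Real.circleAverage (fun w => rate γ η (a + w • b)) 0 1 := by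
  obtain ⟨n, hn, -⟩ := exists_rate_eq γ hη a
  rw [hn]
  rcases eq_or_ne (b n) 0 with hb | hb
  · have h2 := Real.log_pos one_lt_two
    have hlt : ‖a n‖ < ‖b m‖ - ‖a m‖ := by linarith [hm n, hm m]
    have hc : 0 < γ / η := by positivity
    refine lt_of_lt_of_le (b := Real.log (1 + γ / η * (‖b m‖ - ‖a m‖) ^ 2) / Real.log 2) ?_
      (const_le_circleAverage_rate hγ hη a b fun w hw => le_trans ?_ (le_rate hγ hη _ m))
    · gcongr
    · have h0 : 0 ≤ ‖b m‖ - ‖a m‖ := (norm_nonneg _).trans hlt.le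
      have h1 : ‖b m‖ - ‖a m‖ ≤ ‖(a + w • b) m‖ := by
        have := norm_sub_norm_le (w * b m) (-a m)
        rw [norm_mul, hw, one_mul, norm_neg, sub_neg_eq_add, add_comm] at this
        simpa using this
      gcongr
  · exact log_lt_circleAverage_rate hγ hη a b hb

theorem integrable_rate_mulVec (M : Matrix (Fin N) (Fin N) ℂ) :
    Integrable (fun z => rate γ η (M.mulVec z)) (whiteNoise N) := by
  have hc := continuous_rate (N := N) hγ hη
  refine Integrable.mono' (g := fun z => γ / η / Real.log 2 * ∑ n, ‖M.mulVec z n‖ ^ 2)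
    ((integrable_finsetSum _ fun n _ => integrable_norm_sq_mulVec M n).const_mul _)
    (Continuous.aestronglyMeasurable (by fun_prop)) (Filter.Eventually.of_forall fun z => ?_)
  rw [Real.norm_of_nonneg (rate_nonneg hγ hη _)]
  exact rate_le_sum hγ hη _

theorem integrable_rate_prod (A B : Matrix (Fin N) (Fin N) ℂ) (ν : Measure ℝ) [IsFiniteMeasure ν] :
    Integrable (Function.uncurry fun (θ : ℝ) (z : Fin N → ℂ) =>
      rate γ η (A.mulVec z + circleMap 0 1 θ • B.mulVec z)) (ν.prod (whiteNoise N)) := by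
  have hc := continuous_rate (N := N) hγ hη
  have h2 := Real.log_pos one_lt_two
  have hint : Integrable (fun z => γ / η / Real.log 2 *
      ∑ n, (2 * (‖A.mulVec z n‖ ^ 2 + ‖B.mulVec z n‖ ^ 2))) (whiteNoise N) :=
    (integrable_finsetSum _ fun n _ => ((integrable_norm_sq_mulVec A n).add
      (integrable_norm_sq_mulVec B n)).const_mul 2).const_mul _
  refine (hint.comp_snd ν).mono' (Continuous.aestronglyMeasurable ?_)
    (Filter.Eventually.of_forall fun p => ?_)
  · have : Continuous fun p : ℝ × (Fin N → ℂ) => circleMap 0 1 p.1 :=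
      (continuous_circleMap 0 1).comp continuous_fst
    exact hc.comp (by fun_prop)
  · simp only [Function.uncurry]
    rw [Real.norm_of_nonneg (rate_nonneg hγ hη _)]
    refine (rate_le_sum hγ hη _).trans ?_
    gcongr with n
    have h1 : ‖(A.mulVec p.2 + circleMap 0 1 p.1 • B.mulVec p.2) n‖
        ≤ ‖A.mulVec p.2 n‖ + ‖B.mulVec p.2 n‖ := by
      refine (norm_add_le _ _).trans ?_
      simp [circleMap]
    calc _ ≤ (‖A.mulVec p.2 n‖ + ‖B.mulVec p.2 n‖) ^ 2 := by gcongr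
      _ ≤ _ := add_sq_le

/-- If rotating the phase of the component `B z` does not change the law of the channel
`(A + B) z`, then dropping this component strictly lowers the ergodic capacity, as soon as some
input is seen by `B` but not by `A`. -/
theorem integral_rate_lt_of_phase_invariant (A B : Matrix (Fin N) (Fin N) ℂ)
    (hinv : ∀ w : ℂ, ‖w‖ = 1 →
      (whiteNoise N).map (A + w • B).mulVec = (whiteNoise N).map (A + B).mulVec)
    {z₀ : Fin N → ℂ} (hA : A.mulVec z₀ = 0) (hB : B.mulVec z₀ ≠ 0) :
    ∫ z, rate γ η (A.mulVec z) ∂(whiteNoise N)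
      < ∫ z, rate γ η ((A + B).mulVec z) ∂(whiteNoise N) := by
  have hc := continuous_rate (N := N) hγ hη
  have : IsFiniteMeasure (volume.restrict (Set.uIoc 0 (2 * Real.pi))) := by
    rw [Set.uIoc]; infer_instance
  have hprod := integrable_rate_prod hγ hη A B (volume.restrict (Set.uIoc 0 (2 * Real.pi)))
  have hrot : ∀ w : ℂ, ‖w‖ = 1 → ∫ z, rate γ η (A.mulVec z + w • B.mulVec z) ∂(whiteNoise N)
      = ∫ z, rate γ η ((A + B).mulVec z) ∂(whiteNoise N) := by
    intro w hw
    have h : ∫ x, rate γ η x ∂_ = ∫ x, rate γ η x ∂_ :=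
      congrArg (fun μ => ∫ x, rate γ η x ∂μ) (hinv w hw)
    rw [integral_map (by fun_prop) hc.aestronglyMeasurable,
      integral_map (by fun_prop) hc.aestronglyMeasurable] at h
    simpa only [Matrix.add_mulVec, Matrix.smul_mulVec] using h
  have hswap : ∫ z, Real.circleAverage (fun w => rate γ η (A.mulVec z + w • B.mulVec z)) 0 1
      ∂(whiteNoise N) = ∫ z, rate γ η ((A + B).mulVec z) ∂(whiteNoise N) := by
    simp only [Real.circleAverage_def, smul_eq_mul]
    rw [integral_const_mul, ← intervalIntegral_integral_swap hprod,
      intervalIntegral.integral_congr (g := fun _ => ∫ z, rate γ η ((A + B).mulVec z)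
        ∂(whiteNoise N)) fun θ _ => hrot _ (by simp [circleMap]), intervalIntegral.integral_const]
    have := Real.pi_pos
    simp only [sub_zero, smul_eq_mul]
    field_simp
  rw [← hswap]
  have hintR : Integrable (fun z => Real.circleAverage
      (fun w => rate γ η (A.mulVec z + w • B.mulVec z)) 0 1) (whiteNoise N) := by
    simp only [Real.circleAverage_def, smul_eq_mul,
      intervalIntegral.integral_of_le Real.two_pi_pos.le]
    rw [Set.uIoc_of_le Real.two_pi_pos.le] at hprod
    exact hprod.integral_prod_right.const_mul _
  have hA' := integrable_rate_mulVec hγ hη A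
  rw [← sub_pos, ← integral_sub hintR hA', integral_pos_iff_support_of_nonneg
    (fun z => sub_nonneg.2 (rate_le_circleAverage hγ hη _ _)) (hintR.sub hA')]
  obtain ⟨m, hm⟩ := Function.ne_iff.1 hB
  have hopen : IsOpen {z : Fin N → ℂ | ∀ n, 2 * ‖A.mulVec z n‖ < ‖B.mulVec z m‖} := by
    simp only [Set.ofPred_forall]
    exact isOpen_iInter_of_finite fun n => isOpen_lt (by fun_prop) (by fun_prop)
  have hne : {z : Fin N → ℂ | ∀ n, 2 * ‖A.mulVec z n‖ < ‖B.mulVec z m‖}.Nonempty :=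
    ⟨z₀, fun n => by simpa [hA] using hm⟩
  refine (hopen.measure_pos (whiteNoise N) hne).trans_le (measure_mono fun z hz => ?_)
  exact (sub_pos.2 (rate_lt_circleAverage hγ hη _ _ hz)).ne'

end rate

/-! ### The truncated Karhunen–Loève expansion -/

/-- The matrix `M` with `klChannel η U lam z K = M z`: the columns `√η √λₖ uₖ` for the retained modes
`k < K`, and zero columns for the others. -/
noncomputable def klMatrix {N : ℕ} (η : ℝ) (U : Matrix (Fin N) (Fin N) ℂ) (lam : Fin N → ℝ)
    (K : ℕ) : Matrix (Fin N) (Fin N) ℂ :=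
  Matrix.of fun n k => if (k : ℕ) < K then ((√η : ℝ) : ℂ) * (((√(lam k) : ℝ) : ℂ) * U n k) else 0

theorem klChannel_eq_mulVec {Ω : Type*} {N : ℕ} (η : ℝ) (U : Matrix (Fin N) (Fin N) ℂ)
    (lam : Fin N → ℝ) (z : Fin N → Ω → ℂ) (K : ℕ) (ω : Ω) :
    klChannel η U lam z K ω = (klMatrix η U lam K).mulVec fun k => z k ω := by
  funext n
  rw [klChannel, Finset.mul_sum, Finset.sum_filter, Matrix.mulVec, dotProduct]
  refine Finset.sum_congr rfl fun k _ => ?_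
  rw [klMatrix, Matrix.of_apply]
  split_ifs
  · ring
  · ring

theorem klMatrix_mul_conjTranspose {N : ℕ} {η : ℝ} (hη : 0 ≤ η)
    {R U : Matrix (Fin N) (Fin N) ℂ} {lam : Fin N → ℝ} (hlam : ∀ k, 0 ≤ lam k)
    (hU : IsOrderedEigendecomposition R U lam) :
    klMatrix η U lam N * (klMatrix η U lam N).conjTranspose = (η : ℂ) • R := by
  rw [hU.eq]
  ext n m
  rw [Matrix.smul_apply, Matrix.mul_apply, Matrix.mul_apply]
  simp only [Matrix.mul_diagonal, Matrix.conjTranspose_apply,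
    klMatrix, Matrix.of_apply, Fin.is_lt, if_true, smul_eq_mul, Finset.mul_sum]
  refine Finset.sum_congr rfl fun k _ => ?_
  have h1 : ((√η : ℝ) : ℂ) * ((√η : ℝ) : ℂ) = η := by exact_mod_cast Real.mul_self_sqrt hη
  have h2 : ((√(lam k) : ℝ) : ℂ) * ((√(lam k) : ℝ) : ℂ) = lam k := by
    exact_mod_cast Real.mul_self_sqrt (hlam k)
  simp only [star_mul', RCLike.star_def, Complex.conj_ofReal]
  rw [← h1, ← h2]; ring

/-- Rotating the discarded modes by a common phase amounts to a diagonal unitary transformation of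
the white noise. -/
theorem klMatrix_phase_invariant {N : ℕ} (η : ℝ) (U : Matrix (Fin N) (Fin N) ℂ) (lam : Fin N → ℝ)
    (K : ℕ) {w : ℂ} (hw : ‖w‖ = 1) :
    (whiteNoise N).map (klMatrix η U lam K + w • (klMatrix η U lam N - klMatrix η U lam K)).mulVec
      = (whiteNoise N).map (klMatrix η U lam N).mulVec := by
  set V : Matrix (Fin N) (Fin N) ℂ :=
    Matrix.diagonal fun k => if (k : ℕ) < K then 1 else w with hVdef
  have hV : V * V.conjTranspose = 1 := by
    rw [hVdef, Matrix.diagonal_conjTranspose, Matrix.diagonal_mul_diagonal, ← Matrix.diagonal_one]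
    congr 1
    funext k
    simp only [Pi.star_apply]
    split_ifs
    · simp
    · rw [RCLike.star_def, Complex.mul_conj', hw]; simp
  have hM : klMatrix η U lam K + w • (klMatrix η U lam N - klMatrix η U lam K)
      = klMatrix η U lam N * V := by
    ext n k
    simp only [hVdef, Matrix.mul_diagonal, klMatrix, Matrix.add_apply, Matrix.smul_apply,
      Matrix.sub_apply, Matrix.of_apply, Fin.is_lt, if_true, smul_eq_mul]
    split_ifs
    · ring
    · ring
  conv_rhs => rw [← whiteNoise_map_unitary hV]
  rw [Measure.map_map (by fun_prop) (by fun_prop), hM]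
  congr 1
  funext z
  simp [Matrix.mulVec_mulVec]

theorem integral_rate_klMatrix_lt {N : ℕ} [NeZero N] {γ η : ℝ} (hγ : 0 < γ) (hη : 0 < η)
    {R U : Matrix (Fin N) (Fin N) ℂ} {lam : Fin N → ℝ} (hlam : ∀ k, 0 < lam k)
    (hU : IsOrderedEigendecomposition R U lam) {K : ℕ} (hK : K < N) :
    ∫ z, rate γ η ((klMatrix η U lam K).mulVec z) ∂(whiteNoise N)
      < ∫ z, rate γ η ((klMatrix η U lam N).mulVec z) ∂(whiteNoise N) := by
  set A := klMatrix η U lam K with hAdef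
  set B := klMatrix η U lam N - klMatrix η U lam K with hBdef
  have hAB : A + B = klMatrix η U lam N := add_sub_cancel _ _
  rw [← hAB]
  -- The first discarded mode is invisible to `A`; `B` maps it to a nonzero multiple of a column of
  -- the unitary matrix `U`.
  set e : Fin N → ℂ := Pi.single ⟨K, hK⟩ 1 with he
  refine integral_rate_lt_of_phase_invariant hγ hη A B
    (fun w hw => hAB ▸ klMatrix_phase_invariant η U lam K hw) (z₀ := e) ?_ ?_
  · funext n
    simp [he, hAdef, klMatrix]
  · intro h
    have hUU : U.conjTranspose * U = 1 := Matrix.mem_unitaryGroup_iff'.1 hU.unitary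
    have hcol : ∀ n, U n ⟨K, hK⟩ = 0 := by
      intro n
      have := congrFun h n
      simpa [he, hBdef, klMatrix, Real.sqrt_eq_zero', hη.not_ge, (hlam _).not_ge] using this
    have := congrFun (congrFun hUU ⟨K, hK⟩) ⟨K, hK⟩
    simp [Matrix.mul_apply, hcol] at this

end FAS

theorem mainTheorem5 (N : ℕ) (hN : 1 ≤ N) (W : ℝ) (hW : 0 < W)
    (η : ℝ) (hη : 0 < η) (γ : ℝ) (hγ : 0 < γ)
    (U : Matrix (Fin N) (Fin N) ℂ) (lam : Fin N → ℝ)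
    (hU : FAS.IsOrderedEigendecomposition (FAS.jakesMatrix N W) U lam)
    {Ω : Type*} [MeasurableSpace Ω] (P : MeasureTheory.Measure Ω)
    [MeasureTheory.IsProbabilityMeasure P] (g : Ω → Fin N → ℂ)
    (hg : FAS.IsComplexGaussian P ((η : ℂ) • FAS.jakesMatrix N W) g)
    {Ω' : Type*} [MeasurableSpace Ω'] (P' : MeasureTheory.Measure Ω')
    [MeasureTheory.IsProbabilityMeasure P'] (z : Fin N → Ω' → ℂ)
    (hz_indep : ProbabilityTheory.iIndepFun z P')
    (hz_law : ∀ k, ProbabilityTheory.HasLaw (z k) FAS.stdComplexGaussian P')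
    (K : ℕ) (hK : K ≤ N) :
    MeasureTheory.Integrable (fun ω => FAS.rate γ η (g ω)) P ∧
    MeasureTheory.Integrable (fun ω => FAS.rate γ η (FAS.klChannel η U lam z K ω)) P' ∧
    FAS.ergodicCapacity P' γ η (FAS.klChannel η U lam z K) ≤ FAS.ergodicCapacity P γ η g ∧
    (FAS.ergodicCapacity P' γ η (FAS.klChannel η U lam z K) = FAS.ergodicCapacity P γ η g
      ↔ K = N) := by
  have : NeZero N := ⟨by omega⟩
  have hlam := hU.lam_pos hW
  have hc := FAS.continuous_rate (N := N) hγ hη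
  have hzm : AEMeasurable (fun ω k => z k ω) P' :=
    aemeasurable_pi_iff.2 fun k => (hz_law k).aemeasurable
  have hzmap : P'.map (fun ω k => z k ω) = FAS.whiteNoise N := by
    rw [(iIndepFun_iff_map_fun_eq_pi_map fun k => (hz_law k).aemeasurable).1 hz_indep]
    simp only [(hz_law _).map_eq]
  -- `g` has the law of the untruncated expansion.
  have hgmap : P.map g = (FAS.whiteNoise N).map (FAS.klMatrix η U lam N).mulVec := by
    have h := FAS.isComplexGaussian_mulVec_whiteNoise (FAS.klMatrix η U lam N)
    rw [FAS.klMatrix_mul_conjTranspose hη.le (fun k => (hlam k).le) hU] at h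
    exact hg.map_eq h
  have hCg : FAS.ergodicCapacity P γ η g
      = ∫ z, FAS.rate γ η ((FAS.klMatrix η U lam N).mulVec z) ∂(FAS.whiteNoise N) := by
    rw [FAS.ergodicCapacity, ← integral_map hg.aemeasurable hc.aestronglyMeasurable, hgmap,
      integral_map (by fun_prop) hc.aestronglyMeasurable]
  have hCK : FAS.ergodicCapacity P' γ η (FAS.klChannel η U lam z K)
      = ∫ z, FAS.rate γ η ((FAS.klMatrix η U lam K).mulVec z) ∂(FAS.whiteNoise N) := by
    simp only [FAS.ergodicCapacity, FAS.klChannel_eq_mulVec]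
    rw [← hzmap, integral_map hzm (Continuous.aestronglyMeasurable (by fun_prop))]
  have hlt : K < N → FAS.ergodicCapacity P' γ η (FAS.klChannel η U lam z K)
      < FAS.ergodicCapacity P γ η g := by
    intro h
    rw [hCg, hCK]
    exact FAS.integral_rate_klMatrix_lt hγ hη hlam hU h
  have heq : K = N → FAS.ergodicCapacity P' γ η (FAS.klChannel η U lam z K)
      = FAS.ergodicCapacity P γ η g := by
    rintro rfl
    rw [hCg, hCK]
  refine ⟨?_, ?_, ?_, fun h => ?_, heq⟩
  · have h := FAS.integrable_rate_mulVec hγ hη (FAS.klMatrix η U lam N)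
    have h' : Integrable (FAS.rate γ η) (P.map g) := by
      rw [hgmap, integrable_map_measure hc.aestronglyMeasurable (by fun_prop)]
      exact h
    exact h'.comp_aemeasurable hg.aemeasurable
  · have h := FAS.integrable_rate_mulVec hγ hη (FAS.klMatrix η U lam K)
    rw [← hzmap] at h
    simp only [FAS.klChannel_eq_mulVec]
    exact h.comp_aemeasurable hzm
  · exact hK.lt_or_eq.elim (fun h => (hlt h).le) fun h => (heq h).le
  · exact hK.lt_or_eq.elim (fun h' => absurd h (hlt h').ne) id
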